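/- Let $d\ge 1$ and let $\|\cdot\|$ be a norm on $\mathbb{R}^d$, with unit ball $B=\{x:\|x\|\le 1\}$ and unit sphere $S=\{x:\|x\|=1\}$; let $\langle\cdot,\cdot\rangle$ be the Euclidean scalar product and $\|y\|_\star=\sup_{\|x\|\le1}\langle x,y\rangle$ the dual norm. A norm $N$ is *orthant-strictly monotonic* if $N(x)<N(x')$ whenever $|x_i|\le|x'_i|$ and $x_ix'_i\ge0$ for all $i$, and $|x_j|<|x'_j|$ for some $j$. For $K\subset\{1,\dots,d\}$ let $y_K$ coincide with $y$ on $K$ and vanish outside $K$. For $k\in\{1,\dots,d\}$ let $\|y\|^{\rm top}_{k}=\sup_{|K|\le k}\|y_K\|_\star$ (generalized top-$k$ dual norm), let $\|\cdot\|^{\rm sup}_{k}$ be its dual norm (generalized $k$-support dual norm), and let $B_k$ and $S_k$ be the unit ball and unit sphere of $\|\cdot\|^{\rm sup}_{k}$; by convention $\|\cdot\|^{\rm top}_0=0$ and $B_0=S_0=\{0\}$. Let $\ell_0(x)$ be the number of nonzero components of $x$. Let $c(x,y)=\langle x,y\rangle/\|x\|$ for $x\ne0$ and $c(0,y)=0$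 (the Capra coupling), and let $n(x)=x/\|x\|$ for $x\neq 0$, $n(0)=0$. With the convention $(+\infty)+(-\infty)=-\infty$, for $f:\mathbb{R}^d\to[-\infty,+\infty]$ let $f^{c}(y)=\sup_x\big(c(x,y)-f(x)\big)$ and $\partial_c f(x)=\{y: f^c(y)=c(x,y)-f(x)\}$ (Capra-conjugate and Capra-subdifferential), and let $f^{\star}$ and $\partial f(x)$ be the Fenchel conjugate and the Rockafellar–Moreau subdifferential, obtained in the same way with $\langle x,y\rangle$ in place of $c(x,y)$; for a function $g$ of the dual variable let $g^{\star'}(x)=\sup_y\big(\langle x,y\rangle-g(y)\big)$. A function $f:\mathbb{R}^d\to[-\infty,+\infty]$ is convex if its epigraph in $\mathbb{R}^d\times\mathbb{R}$ is convex, and proper if it never takes the value $-\infty$ and is not identically $+\infty$. Let $\delta_A$ be $0$ on $A$ and $+\infty$ outside $A$, and let $\Delta_{d+1}=\{(\lambda_0,\dots,\lambda_d):\lambda_l\ge 0,\ \sum_{l=0}^d\lambda_l=1\}$. **Proposition.** Suppose that both $\|\cdot\|$ and $\|\cdot\|_\star$ are orthant-strictly monotonic. Let $\varphi:\{0,\dots,d\}\to[0,+\infty)$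 be nondecreasing with $\varphi(0)=0$, and let $L=\big((\varphi\circ\ell_0)^{c}\big)^{\star'}$. Then: (a) $L$ is proper, convex and lower semicontinuous (lsc). (b) $(\varphi\circ\ell_0)(s)=L(s)$ for all $s\in S$. (c) $\partial_c(\varphi\circ\ell_0)(s)=\partial L(s)$ for all $s\in S$. (d) $\varphi\circ\ell_0=L\circ n$; equivalently, $\varphi(\ell_0(x))=L(x/\|x\|)$ for all $x\ne0$. (e) $L=\big(\sup_{0\le l\le d}\,[\,\|\cdot\|^{\rm top}_{l}-\varphi(l)]\big)^{\star'}$. (f) $L$ is the largest convex lsc function below $x\mapsto\inf_{0\le l\le d}[\delta_{B_l}(x)+\varphi(l)]$; this function equals $\varphi(l)$ on $B_l\setminus B_{l-1}$ for $1\le l\le d$, equals $0$ at $0$, and is $+\infty$ outside $B_d$, where $B_0\subset B_1\subset\dots\subset B_d=B$. (g) $L$ is the largest convex lsc function below $x\mapsto\inf_{0\le l\le d}[\delta_{S_l}(x)+\varphi(l)]=\inf\{\varphi(l): 0\le l\le d,\ x\in S_l\}$ (with $\inf\emptyset=+\infty$). (h) For all $x\in\mathbb{R}^d$, $$L(x)=\min_{\substack{\lambda\in\Delta_{d+1}\\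 x\in\sum_{l=1}^d\lambda_lB_l}}\sum_{l=1}^d\lambda_l\varphi(l)=\min_{\substack{\lambda\in\Delta_{d+1}\\ x\in\sum_{l=1}^d\lambda_lS_l}}\sum_{l=1}^d\lambda_l\varphi(l)=\min_{\substack{x^{(1)},\dots,x^{(d)}\in\mathbb{R}^d\\ \sum_{l=1}^d\|x^{(l)}\|^{\rm sup}_{l}\le1\\ \sum_{l=1}^dx^{(l)}=x}}\sum_{l=1}^d\varphi(l)\,\|x^{(l)}\|^{\rm sup}_{l},$$ where each minimum is attained whenever its feasible set is nonempty, and equals $+\infty$ otherwise. -/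

import Mathlib

open scoped Pointwise

namespace Capra

noncomputable section

/-! ### Generalized conjugacies for functions with values in `[-∞, +∞]`

Addition on `EReal` satisfies `⊤ + ⊥ = ⊥ + ⊤ = ⊥`, so it is Moreau's lower addition. -/

/-- The Fenchel-Moreau conjugate `y ↦ sup_x (c(x, y) ∔ (-f(x)))` of `f` for a finite coupling. -/
def conjugate {X Y : Type*} (c : X → Y → ℝ) (f : X → EReal) (y : Y) : EReal :=
  ⨆ x : X, ((c x y : EReal) + -(f x))

/-- The subdifferential of `f` at `x` with respect to the coupling `c`. -/
def subdifferential {X Y : Type*} (c : X → Y → ℝ) (f : X → EReal) (x : X) : Set Y :=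
  {y | conjugate c f y = (c x y : EReal) + -(f x)}

/-- The scalar product of `ℝ^d`, as a coupling. -/
def scalarProduct {d : ℕ} (x y : Fin d → ℝ) : ℝ := x ⬝ᵥ y

/-- The reverse Fenchel conjugate `x ↦ sup_y (⟨x, y⟩ ∔ (-g(y)))`. -/
def reverseFenchel {d : ℕ} (g : (Fin d → ℝ) → EReal) : (Fin d → ℝ) → EReal :=
  conjugate (fun y x => scalarProduct x y) g

/-- The coupling that is constant along primal rays, for the source norm `N`. -/
def coupling {d : ℕ} (N : (Fin d → ℝ) → ℝ) (x y : Fin d → ℝ) : ℝ :=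
  if x = 0 then 0 else scalarProduct x y / N x

/-- The normalization mapping. -/
def normalization {d : ℕ} (N : (Fin d → ℝ) → ℝ) (x : Fin d → ℝ) : Fin d → ℝ :=
  if x = 0 then 0 else (N x)⁻¹ • x

/-! ### Convexity notions for functions with values in `[-∞, +∞]` -/

/-- Convexity: the epigraph (a subset of `E × ℝ`) is convex. -/
def IsConvex {E : Type*} [AddCommGroup E] [Module ℝ E] (f : E → EReal) : Prop :=
  Convex ℝ {p : E × ℝ | f p.1 ≤ (p.2 : EReal)}

/-- The function never takes the value `-∞` and is not identically `+∞`. -/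
def IsProper {E : Type*} (f : E → EReal) : Prop :=
  (∀ x, f x ≠ ⊥) ∧ ∃ x, f x ≠ ⊤

/-- `f` is the largest convex lower semicontinuous function below `h`. -/
def IsLargestConvexLscBelow {d : ℕ} (f h : (Fin d → ℝ) → EReal) : Prop :=
  IsGreatest {g : (Fin d → ℝ) → EReal | IsConvex g ∧ LowerSemicontinuous g ∧ g ≤ h} f

open Classical in
/-- The function equal to `0` on `S` and to `+∞` outside of `S`. -/
def indicator {E : Type*} (S : Set E) (x : E) : EReal := if x ∈ S then 0 else ⊤

/-- `a` is the minimum of `cost` over the feasible set `S`: it is the infimum (hence `+∞` if `S` is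
empty), and it is attained as soon as `S` is nonempty. -/
def IsMinOver {α : Type*} (S : Set α) (cost : α → ℝ) (a : EReal) : Prop :=
  (a = ⨅ s ∈ S, (cost s : EReal)) ∧ (S.Nonempty → ∃ s ∈ S, a = (cost s : EReal))

/-! ### The pseudonorm `ℓ₀` and the norms attached to the source norm -/

/-- The number of nonzero components, an element of `{0, …, d}`. -/
def lzero {d : ℕ} (x : Fin d → ℝ) : Fin (d + 1) :=
  ⟨(Finset.univ.filter fun i => x i ≠ 0).card,
    Nat.lt_succ_of_le ((Finset.card_filter_le _ _).trans_eq (Finset.card_fin d))⟩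

/-- Orthant-strict monotonicity. -/
def OrthantStrictlyMonotonic {d : ℕ} (N : (Fin d → ℝ) → ℝ) : Prop :=
  ∀ x x' : Fin d → ℝ, (∀ i, |x i| ≤ |x' i|) → (∃ j, |x j| < |x' j|) → (∀ i, 0 ≤ x i * x' i) →
    N x < N x'

/-- The dual norm `y ↦ sup_{N x ≤ 1} ⟨x, y⟩`. -/
def dualNorm {d : ℕ} (N : (Fin d → ℝ) → ℝ) (y : Fin d → ℝ) : ℝ :=
  sSup ((fun x => scalarProduct x y) '' {x | N x ≤ 1})

/-- The vector `y_K`, which coincides with `y` on `K` and vanishes outside of `K`. -/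
def restrict {d : ℕ} (K : Finset (Fin d)) (y : Fin d → ℝ) : Fin d → ℝ :=
  fun i => if i ∈ K then y i else 0

/-- The generalized top-`k` dual norm `y ↦ sup_{|K| ≤ k} ‖y_K‖_⋆` (a maximum over finitely many
sets `K`; it is the null function for `k = 0`). -/
def topDualNorm {d : ℕ} (N : (Fin d → ℝ) → ℝ) (k : ℕ) (y : Fin d → ℝ) : ℝ :=
  ⨆ K : {K : Finset (Fin d) // K.card ≤ k}, dualNorm N (restrict K.1 y)

/-- The generalized `k`-support dual norm, dual to the generalized top-`k` dual norm; null for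
`k = 0` by convention. -/
def supportDualNorm {d : ℕ} (N : (Fin d → ℝ) → ℝ) (k : ℕ) : (Fin d → ℝ) → ℝ :=
  if k = 0 then 0 else dualNorm (topDualNorm N k)

/-- The unit ball of the generalized `k`-support dual norm; `{0}` for `k = 0` by convention. -/
def supportBall {d : ℕ} (N : (Fin d → ℝ) → ℝ) (k : ℕ) : Set (Fin d → ℝ) :=
  if k = 0 then {0} else {x | supportDualNorm N k x ≤ 1}

/-- The unit sphere of the generalized `k`-support dual norm; `{0}` for `k = 0` by convention. -/
def supportSphere {d : ℕ} (N : (Fin d → ℝ) → ℝ) (k : ℕ) : Set (Fin d → ℝ) :=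
  if k = 0 then {0} else {x | supportDualNorm N k x = 1}

/-! ### The functions in the result -/

/-- The function `φ ∘ ℓ₀`. -/
def phiLzero {d : ℕ} (φ : Fin (d + 1) → ℝ) (x : Fin d → ℝ) : EReal := (φ (lzero x) : EReal)

/-- The function `L`: the reverse Fenchel conjugate of the Capra-conjugate of `φ ∘ ℓ₀`. -/
def calL {d : ℕ} (N : (Fin d → ℝ) → ℝ) (φ : Fin (d + 1) → ℝ) : (Fin d → ℝ) → EReal :=
  reverseFenchel (conjugate (coupling N) (phiLzero φ))

/-- `x ↦ inf_{0 ≤ l ≤ d} (δ_{B_l}(x) + φ(l))`, for a family of sets `B_0, …, B_d`. -/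
def stepFunction {d : ℕ} (B : ℕ → Set (Fin d → ℝ)) (φ : Fin (d + 1) → ℝ) (x : Fin d → ℝ) :
    EReal :=
  ⨅ l : Fin (d + 1), (indicator (B l) x + (φ l : EReal))

/-- The `(λ_0, …, λ_d)` in the simplex with `x ∈ ∑_{l=1}^d λ_l B_l` (Minkowski sum). -/
def simplexFeasible {d : ℕ} (B : ℕ → Set (Fin d → ℝ)) (x : Fin d → ℝ) : Set (Fin (d + 1) → ℝ) :=
  {w | w ∈ stdSimplex ℝ (Fin (d + 1)) ∧ x ∈ ∑ l : Fin d, w l.succ • B (l + 1)}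

/-- The `(x^(1), …, x^(d))` with sum `x` and `∑_{l=1}^d ‖x^(l)‖ ≤ 1`, the norm of `x^(l)` being the
generalized `l`-support dual norm. The entry of index `l : Fin d` is `x^(l+1)`. -/
def decompositions {d : ℕ} (N : (Fin d → ℝ) → ℝ) (x : Fin d → ℝ) : Set (Fin d → Fin d → ℝ) :=
  {z | ∑ l : Fin d, supportDualNorm N (l + 1) (z l) ≤ 1 ∧ ∑ l : Fin d, z l = x}

end

end Capra

open Capra

/-!
By orthant-strict monotonicity of the source norm, the supremum defining the top-`k` dual norm is
attained at a vector with at most `k` nonzero components. Hence the Capra-conjugate of `φ ∘ ℓ₀` is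
`y ↦ max_l (‖y‖^top_l - φ(l))`, and `L` is its reverse Fenchel conjugate.

The minimal cost of a decomposition of `x` with `∑ ‖x^(l)‖^sup_l ≤ 1` is a convex program whose dual
value is `L(x)`, because the infimum of the Lagrangian over the unit ball of the norm
`z ↦ ∑ ‖z^(l)‖^sup_l` is attained at `0` or at a vector with a single nonzero component. As this
ball is compact, Sion's minimax theorem gives strong duality and the minimum is attained. Splitting
each `x^(l)` into its norm and a unit vector yields the expressions on balls and on spheres, and
then Jensen's inequality shows that `L` dominates every convex function below the step functions.

For the factorization, `L ∘ n ≤ φ ∘ ℓ₀` holds for every biconjugate. Conversely, take a norming dual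
vector `y` of `x` with the support of `x`: strict monotonicity of the dual norm makes the top-`k`
dual norm of `y` smaller than `‖y‖_⋆ = 1` for `k < ℓ₀(x)`, so that for large `m` the affine minorant
of `L` with slope `m y` takes at `n(x)` a value at least `φ(ℓ₀(x))`.
-/

namespace Capra

section Conjugacy

variable {X X' Y : Type*} {c : X → Y → ℝ} {f f' : X → EReal} {g : Y → EReal}

theorem coe_add_neg_le_comm {r : ℝ} {a b : EReal} :
    (r : EReal) + -a ≤ b ↔ (r : EReal) + -b ≤ a := by
  induction a <;> induction b <;> try simp
  norm_cast
  constructor <;> intro h <;> linarith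

theorem conjugate_le_iff : conjugate c f ≤ g ↔ conjugate (flip c) g ≤ f := by
  simp only [Pi.le_def, conjugate, iSup_le_iff, coe_add_neg_le_comm (a := f _), flip]
  exact forall_comm

theorem conjugate_flip_conjugate_le : conjugate (flip c) (conjugate c f) ≤ f :=
  conjugate_le_iff.1 le_rfl

theorem conjugate_anti (h : f ≤ f') : conjugate c f' ≤ conjugate c f :=
  conjugate_le_iff.2 (conjugate_flip_conjugate_le.trans h)

theorem conjugate_coe (c : X → Y → ℝ) (f : X → ℝ) (y : Y) :
    conjugate c (fun x => (f x : EReal)) y = ⨆ x, ((c x y - f x : ℝ) : EReal) :=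
  iSup_congr fun x => (EReal.coe_sub (c x y) (f x)).symm

theorem conjugate_le_coe_iff {y : Y} {r : ℝ} :
    conjugate c f y ≤ (r : EReal) ↔ ∀ x, ((c x y - r : ℝ) : EReal) ≤ f x := by
  simp only [conjugate, iSup_le_iff, coe_add_neg_le_comm (a := f _), EReal.coe_sub]
  rfl

theorem conjugate_flip_conjugate_comp_le (c : X → Y → ℝ) (n : X' → X) (f : X' → EReal) :
    conjugate (flip c) (conjugate (c ∘ n) f) ∘ n ≤ f :=
  conjugate_flip_conjugate_le (c := c ∘ n)

theorem conjugate_conjugate_flip_conjugate_comp (c : X → Y → ℝ) (n : X' → X) (f : X' → EReal) :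
    conjugate c (conjugate (flip c) (conjugate (c ∘ n) f)) = conjugate (c ∘ n) f :=
  (conjugate_flip_conjugate_le (c := flip c)).antisymm
    ((conjugate_anti (conjugate_flip_conjugate_comp_le c n f)).trans fun y =>
      iSup_comp_le (fun x => (c x y : EReal) + -_) n)

theorem isConvex_conjugate [AddCommGroup Y] [Module ℝ Y]
    (hc : ∀ x, ConvexOn ℝ Set.univ (c x)) (f : X → EReal) : IsConvex (conjugate c f) := by
  rintro ⟨y, s⟩ hy ⟨y', s'⟩ hy' a b ha hb hab
  simp only [Set.mem_ofPred_eq, Prod.smul_mk, Prod.mk_add_mk, conjugate_le_coe_iff, smul_eq_mul]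
    at hy hy' ⊢
  intro x
  have hconv : c x (a • y + b • y') ≤ a * c x y + b * c x y' :=
    (hc x).2 trivial trivial ha hb hab
  have hmax : a * (c x y - s) + b * (c x y' - s') ≤ max (c x y - s) (c x y' - s') :=
    Convex.combo_le_max _ _ ha hb hab
  calc ((c x (a • y + b • y') - (a * s + b * s') : ℝ) : EReal)
      ≤ (max (c x y - s) (c x y' - s') : ℝ) := by norm_cast; linarith
    _ ≤ f x := by
      rw [EReal.coe_strictMono.monotone.map_max]
      exact max_le (hy x) (hy' x)

theorem lowerSemicontinuous_conjugate [TopologicalSpace Y]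
    (hc : ∀ x, Continuous (c x)) (f : X → EReal) : LowerSemicontinuous (conjugate c f) := by
  refine lowerSemicontinuous_iSup fun x => Continuous.lowerSemicontinuous ?_
  refine continuous_iff_continuousAt.2 fun y => ?_
  exact (EReal.continuousAt_add (p := (↑(c x y), -f x)) (by simp) (by simp)).comp_of_eq
    ((continuous_coe_real_ereal.comp (hc x)).continuousAt.prodMk continuousAt_const) rfl

end Conjugacy

section IsMinOver

variable {α β : Type*} {S : Set α} {T : Set β} {cost : α → ℝ} {cost' : β → ℝ} {a : EReal}

theorem IsMinOver.of_isCompact [TopologicalSpace α] (hS : IsCompact S)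
    (hcost : ContinuousOn cost S) (ha : a = ⨅ s ∈ S, (cost s : EReal)) : IsMinOver S cost a := by
  refine ⟨ha, fun hne => ?_⟩
  obtain ⟨s, hs, hmin⟩ := hS.exists_isMinOn hne hcost
  exact ⟨s, hs, ha.trans ((iInf₂_le s hs).antisymm
    (le_iInf₂ fun s' hs' => EReal.coe_le_coe_iff.2 (hmin hs')))⟩

theorem IsMinOver.transfer (h : IsMinOver S cost a)
    (hST : ∀ s ∈ S, ∃ t ∈ T, cost' t ≤ cost s) (hTS : ∀ t ∈ T, ∃ s ∈ S, cost s ≤ cost' t) :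
    IsMinOver T cost' a := by
  have ha : a = ⨅ t ∈ T, (cost' t : EReal) :=
    h.1.trans (le_antisymm
      (le_iInf₂ fun t ht =>
        let ⟨s, hs, hst⟩ := hTS t ht
        (iInf₂_le s hs).trans (EReal.coe_le_coe_iff.2 hst))
      (le_iInf₂ fun s hs =>
        let ⟨t, ht, hts⟩ := hST s hs
        (iInf₂_le t ht).trans (EReal.coe_le_coe_iff.2 hts)))
  refine ⟨ha, fun ⟨t, ht⟩ => ?_⟩
  obtain ⟨s, hs, -⟩ := hTS t ht
  obtain ⟨s, hs, has⟩ := h.2 ⟨s, hs⟩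
  obtain ⟨t, ht, hts⟩ := hST s hs
  exact ⟨t, ht, (ha.trans_le (iInf₂_le t ht)).antisymm
    ((EReal.coe_le_coe_iff.2 hts).trans_eq has.symm)⟩

end IsMinOver

section IsNorm

/-- The real function `f` on a real vector space is a norm. The norms of this file are values of
operations on functions, such as `dualNorm`, hence the unbundled predicate. -/
structure IsNorm {E : Type*} [AddCommGroup E] [Module ℝ E] (f : E → ℝ) : Prop where
  exists_seminorm_eq : ∃ p : Seminorm ℝ E, ⇑p = f
  eq_zero_of_map_eq_zero : ∀ x, f x = 0 → x = 0

namespace IsNorm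

variable {E : Type*} [AddCommGroup E] [Module ℝ E] {f : E → ℝ} {x : E}

theorem nonneg (hf : IsNorm f) (x : E) : 0 ≤ f x := by
  obtain ⟨⟨p, rfl⟩, -⟩ := hf
  exact apply_nonneg p x

theorem map_zero (hf : IsNorm f) : f 0 = 0 := by
  obtain ⟨⟨p, rfl⟩, -⟩ := hf
  exact _root_.map_zero p

theorem add_le (hf : IsNorm f) (x y : E) : f (x + y) ≤ f x + f y := by
  obtain ⟨⟨p, rfl⟩, -⟩ := hf
  exact map_add_le_add p x y

theorem smul_eq (hf : IsNorm f) (a : ℝ) (x : E) : f (a • x) = |a| * f x := by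
  obtain ⟨⟨p, rfl⟩, -⟩ := hf
  exact map_smul_eq_mul p a x

theorem smul_of_nonneg (hf : IsNorm f) {a : ℝ} (ha : 0 ≤ a) (x : E) : f (a • x) = a * f x := by
  rw [hf.smul_eq, abs_of_nonneg ha]

theorem pos (hf : IsNorm f) (hx : x ≠ 0) : 0 < f x :=
  (hf.nonneg x).lt_of_ne' (mt (hf.eq_zero_of_map_eq_zero x) hx)

theorem convexOn (hf : IsNorm f) : ConvexOn ℝ Set.univ f := by
  obtain ⟨⟨p, rfl⟩, -⟩ := hf
  exact p.convexOn

theorem map_inv_smul_self (hf : IsNorm f) (hx : x ≠ 0) : f ((f x)⁻¹ • x) = 1 := by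
  rw [hf.smul_of_nonneg (inv_nonneg.2 (hf.nonneg x)), inv_mul_cancel₀ (hf.pos hx).ne']

theorem exists_smul_eq [Nontrivial E] (hf : IsNorm f) (x : E) : ∃ u, f u = 1 ∧ f x • u = x := by
  rcases eq_or_ne x 0 with rfl | hx
  · obtain ⟨v, hv⟩ := exists_ne (0 : E)
    exact ⟨_, hf.map_inv_smul_self hv, by rw [hf.map_zero, zero_smul]⟩
  · exact ⟨_, hf.map_inv_smul_self hx, smul_inv_smul₀ (hf.pos hx).ne' x⟩

theorem sum {ι : Type*} [Fintype ι] {ν : ι → E → ℝ} (hν : ∀ i, IsNorm (ν i)) :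
    IsNorm fun z : ι → E => ∑ i, ν i (z i) := by
  choose p hp using fun i => (hν i).exists_seminorm_eq
  refine ⟨⟨∑ i, (p i).comp (LinearMap.proj i), ?_⟩, fun z hz => funext fun i => ?_⟩
  · ext z
    simp [← hp]
  · rw [Finset.sum_eq_zero_iff_of_nonneg fun i _ => (hν i).nonneg (z i)] at hz
    exact (hν i).eq_zero_of_map_eq_zero _ (hz i (Finset.mem_univ i))

end IsNorm

namespace IsNorm

variable {E : Type*} [NormedAddCommGroup E] [NormedSpace ℝ E] [FiniteDimensional ℝ E] {f : E → ℝ}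

theorem continuous (hf : IsNorm f) : Continuous f :=
  continuousOn_univ.1 (hf.convexOn.continuousOn isOpen_univ)

theorem exists_mul_norm_le (hf : IsNorm f) : ∃ r > 0, ∀ x, r * ‖x‖ ≤ f x := by
  have := FiniteDimensional.proper_real E
  obtain ⟨r, hr, hle⟩ := (isCompact_sphere (0 : E) 1).exists_forall_le'
    hf.continuous.continuousOn (a := 0) fun x hx => hf.pos (ne_zero_of_mem_unit_sphere ⟨x, hx⟩)
  refine ⟨r, hr, fun x => ?_⟩
  rcases eq_or_ne x 0 with rfl | hx
  · simp [hf.map_zero]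
  have hunit : r ≤ f (‖x‖⁻¹ • x) := hle _ (by simpa using norm_smul_inv_norm (𝕜 := ℝ) hx)
  rwa [hf.smul_of_nonneg (by positivity), ← div_eq_inv_mul, le_div_iff₀ (norm_pos_iff.2 hx)]
    at hunit

theorem isCompact_le (hf : IsNorm f) (r : ℝ) : IsCompact {x | f x ≤ r} := by
  have := FiniteDimensional.proper_real E
  obtain ⟨s, hs, hle⟩ := hf.exists_mul_norm_le
  refine (isCompact_closedBall (0 : E) (r / s)).of_isClosed_subset
    (isClosed_le hf.continuous continuous_const) fun x hx => ?_
  rw [mem_closedBall_zero_iff, le_div_iff₀' hs]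
  exact (hle x).trans hx

end IsNorm

end IsNorm

section DualNorm

variable {d : ℕ} {f : (Fin d → ℝ) → ℝ} {x y : Fin d → ℝ}

theorem scalarProduct_comm (x y : Fin d → ℝ) : scalarProduct x y = scalarProduct y x :=
  dotProduct_comm x y

theorem scalarProduct_smul (a : ℝ) (x y : Fin d → ℝ) :
    scalarProduct x (a • y) = a * scalarProduct x y :=
  dotProduct_smul a x y

theorem smul_scalarProduct (a : ℝ) (x y : Fin d → ℝ) :
    scalarProduct (a • x) y = a * scalarProduct x y :=
  smul_dotProduct a x y

theorem zero_scalarProduct (y : Fin d → ℝ) : scalarProduct 0 y = 0 :=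
  zero_dotProduct y

theorem scalarProduct_self_pos (hx : x ≠ 0) : 0 < scalarProduct x x :=
  Matrix.dotProduct_star_self_pos_iff.2 hx

theorem convexOn_scalarProduct (y : Fin d → ℝ) : ConvexOn ℝ Set.univ (scalarProduct · y) :=
  ((dotProductBilin ℝ ℝ).flip y).convexOn convex_univ

theorem continuous_scalarProduct (y : Fin d → ℝ) : Continuous (scalarProduct · y) :=
  Continuous.dotProduct continuous_id continuous_const

namespace IsNorm

theorem scalarProduct_le_dualNorm (hf : IsNorm f) (hx : f x ≤ 1) (y : Fin d → ℝ) :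
    scalarProduct x y ≤ dualNorm f y :=
  le_csSup ((hf.isCompact_le 1).image (continuous_scalarProduct y)).bddAbove ⟨x, hx, rfl⟩

theorem exists_dualNorm_eq (hf : IsNorm f) (y : Fin d → ℝ) :
    ∃ x, f x ≤ 1 ∧ scalarProduct x y = dualNorm f y :=
  let ⟨x, hx, hxy⟩ := (hf.isCompact_le 1).exists_sSup_image_eq
    ⟨0, hf.map_zero.trans_le zero_le_one⟩ (continuous_scalarProduct y).continuousOn
  ⟨x, hx, hxy.symm⟩

theorem scalarProduct_le (hf : IsNorm f) (x y : Fin d → ℝ) :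
    scalarProduct x y ≤ f x * dualNorm f y := by
  rcases eq_or_ne x 0 with rfl | hx
  · rw [hf.map_zero, zero_mul, zero_scalarProduct]
  have hunit := hf.scalarProduct_le_dualNorm (hf.map_inv_smul_self hx).le y
  rwa [smul_scalarProduct, inv_mul_le_iff₀ (hf.pos hx)] at hunit

theorem dual (hf : IsNorm f) : IsNorm (dualNorm f) where
  exists_seminorm_eq := by
    refine ⟨.ofSMulLE (dualNorm f) ?_ (fun y z => ?_) fun a y => ?_, rfl⟩
    · obtain ⟨x, -, hx⟩ := hf.exists_dualNorm_eq 0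
      rw [← hx, scalarProduct_comm, zero_scalarProduct]
    · obtain ⟨x, hx, hxyz⟩ := hf.exists_dualNorm_eq (y + z)
      rw [← hxyz]
      exact (dotProduct_add x y z).trans_le
        (add_le_add (hf.scalarProduct_le_dualNorm hx y) (hf.scalarProduct_le_dualNorm hx z))
    · obtain ⟨x, hx, hxay⟩ := hf.exists_dualNorm_eq (a • y)
      have hy : 0 ≤ dualNorm f y := (zero_scalarProduct y).symm.trans_le
        (hf.scalarProduct_le_dualNorm (hf.map_zero.trans_le zero_le_one) y)
      rw [← hxay, scalarProduct_smul, ← smul_scalarProduct]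
      calc scalarProduct (a • x) y ≤ f (a • x) * dualNorm f y := hf.scalarProduct_le _ y
        _ = ‖a‖ * (f x * dualNorm f y) := by rw [hf.smul_eq, mul_assoc, Real.norm_eq_abs]
        _ ≤ ‖a‖ * dualNorm f y :=
          mul_le_mul_of_nonneg_left (mul_le_of_le_one_left hy hx) (norm_nonneg a)
  eq_zero_of_map_eq_zero y hy := by
    by_contra hne
    exact (scalarProduct_self_pos hne).not_ge
      (by simpa only [hy, mul_zero] using hf.scalarProduct_le y y)

theorem dualNorm_le_one_iff (hf : IsNorm f) :
    dualNorm f x ≤ 1 ↔ ∀ y, scalarProduct x y ≤ f y := by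
  refine ⟨fun hx y => ?_, fun h => ?_⟩
  · rw [scalarProduct_comm]
    exact (hf.scalarProduct_le y x).trans (mul_le_of_le_one_right (hf.nonneg y) hx)
  · obtain ⟨y, hy, hyx⟩ := hf.exists_dualNorm_eq x
    rw [← hyx, scalarProduct_comm]
    exact (h y).trans hy

theorem exists_norming (hf : IsNorm f) (hx : x ≠ 0) :
    ∃ y, dualNorm f y ≤ 1 ∧ scalarProduct x y = f x := by
  obtain ⟨⟨p, rfl⟩, -⟩ := id hf
  obtain ⟨g, hg, hgp⟩ := Module.Dual.exists_extension_of_le_seminorm_real _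
    (LinearPMap.mkSpanSingleton x (p x) hx).toFun (p := p) (by
      rintro ⟨z, hz⟩
      obtain ⟨a, rfl⟩ := Submodule.mem_span_singleton.1 hz
      calc _ = a * p x := LinearPMap.mkSpanSingleton'_apply _ _ _ _ _
        _ ≤ |a| * p x := by gcongr; exact le_abs_self a
        _ = p (a • x) := (map_smul_eq_mul p a x).symm)
  have hrepr : ∀ z, scalarProduct ((dotProductEquiv ℝ (Fin d)).symm g) z = g z :=
    LinearMap.congr_fun ((dotProductEquiv ℝ (Fin d)).apply_symm_apply g)
  refine ⟨_, hf.dualNorm_le_one_iff.2 fun z => (hrepr z).trans_le ((le_abs_self _).trans (hgp z)),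
    ?_⟩
  rw [scalarProduct_comm, hrepr, hg ⟨x, Submodule.mem_span_singleton_self x⟩]
  exact LinearPMap.mkSpanSingleton'_apply_self _ _ _ _

theorem dualNorm_dualNorm (hf : IsNorm f) : dualNorm (dualNorm f) = f := by
  funext x
  refine le_antisymm ?_ ?_
  · obtain ⟨y, hy, hyx⟩ := hf.dual.exists_dualNorm_eq x
    rw [← hyx]
    exact hf.dualNorm_le_one_iff.1 hy x
  · rcases eq_or_ne x 0 with rfl | hx
    · rw [hf.map_zero, hf.dual.dual.map_zero]
    obtain ⟨y, hy, hxy⟩ := hf.exists_norming hx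
    rw [← hxy, scalarProduct_comm]
    exact hf.dual.scalarProduct_le_dualNorm hy x

end IsNorm

end DualNorm

section Minimax

theorem exists_forall_lt_of_convexOn_of_concaveOn {E F : Type*}
    [AddCommGroup E] [Module ℝ E] [TopologicalSpace E] [IsTopologicalAddGroup E]
    [ContinuousSMul ℝ E] [AddCommGroup F] [Module ℝ F] [TopologicalSpace F]
    [IsTopologicalAddGroup F] [ContinuousSMul ℝ F] {X : Set E} {Y : Set F} {f : E → F → ℝ}
    (hX : IsCompact X) (hX_nonempty : X.Nonempty)
    (hf_convex : ∀ y ∈ Y, ConvexOn ℝ X (f · y)) (hf_continuous : ∀ y ∈ Y, ContinuousOn (f · y) X)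
    (hf_concave : ∀ x ∈ X, ConcaveOn ℝ Y (f x)) (hf_continuous' : ∀ x ∈ X, ContinuousOn (f x) Y)
    {t : ℝ} (h : ∀ x ∈ X, ∃ y ∈ Y, t < f x y) : ∃ y ∈ Y, ∀ x ∈ X, t < f x y := by
  have hlsc : ∀ y ∈ Y, LowerSemicontinuousOn (f · y) X :=
    fun y hy => (hf_continuous y hy).lowerSemicontinuousOn
  obtain ⟨s, hs⟩ : ∃ s : Finset Y, ∀ x ∈ X, ∃ y ∈ s, t < f x y := by
    refine (LowerSemicontinuousOn.inter_biInter_preimage_Iic_eq_empty_iff_exists_finset hX hlsc).1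
      (Set.eq_empty_of_forall_notMem fun x ⟨hx, hle⟩ => ?_)
    obtain ⟨y, hy, hlt⟩ := h x hx
    exact hlt.not_ge (Set.mem_iInter₂.1 hle y hy)
  obtain ⟨x, hx⟩ := hX_nonempty
  obtain ⟨y, hy, -⟩ := h x hx
  exact Sion.exists_lt_iInf_of_lt_iInf_of_finite ⟨x, hx⟩ hX hlsc
    (fun y hy => (hf_convex y hy).quasiconvexOn) (hf_concave x hx).1
    (fun x hx => (hf_continuous' x hx).upperSemicontinuousOn)
    (fun x hx => (hf_concave x hx).quasiconcaveOn) (hf_convex y hy).1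
    (s.finite_toSet.image Subtype.val) (Subtype.coe_image_subset Y s)
    fun x hx => let ⟨y, hy, hlt⟩ := hs x hx; ⟨y, ⟨y, hy, rfl⟩, hlt⟩

end Minimax

section UnitDecompositions

variable {ι : Type*} [Fintype ι] {d : ℕ} {ν : ι → (Fin d → ℝ) → ℝ} {w : ι → ℝ}
  {g : (Fin d → ℝ) → ℝ} {x : Fin d → ℝ}

/-- The decompositions of `x` into vectors `z i` with `∑ i, ν i (z i) ≤ 1`, for a family `ν` of
norms. -/
def unitDecompositions (ν : ι → (Fin d → ℝ) → ℝ) (x : Fin d → ℝ) : Set (ι → Fin d → ℝ) :=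
  {z | ∑ i, ν i (z i) ≤ 1 ∧ ∑ i, z i = x}

theorem IsNorm.isCompact_unitDecompositions (hν : ∀ i, IsNorm (ν i)) (x : Fin d → ℝ) :
    IsCompact (unitDecompositions ν x) :=
  ((IsNorm.sum hν).isCompact_le 1).inter_right (isClosed_eq (by fun_prop) continuous_const)

/-- The Lagrangian of the minimization of `∑ i, w i * ν i (z i)` over the unit decompositions `z` of
`x`: the multiplier `y` penalizes the constraint `∑ i, z i = x`, whereas `∑ i, ν i (z i) ≤ 1` is
kept as a constraint. -/
def lagrangian (ν : ι → (Fin d → ℝ) → ℝ) (w : ι → ℝ) (x : Fin d → ℝ) (z : ι → Fin d → ℝ)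
    (y : Fin d → ℝ) : ℝ :=
  scalarProduct (x - ∑ i, z i) y + ∑ i, w i * ν i (z i)

theorem lagrangian_eq (ν : ι → (Fin d → ℝ) → ℝ) (w : ι → ℝ) (x : Fin d → ℝ)
    (z : ι → Fin d → ℝ) (y : Fin d → ℝ) :
    lagrangian ν w x z y =
      scalarProduct x y + ∑ i, (w i * ν i (z i) - scalarProduct (z i) y) := by
  simp only [lagrangian, scalarProduct, sub_dotProduct, sum_dotProduct, Finset.sum_sub_distrib]
  ring

theorem convexOn_lagrangian (hν : ∀ i, IsNorm (ν i)) (hw : ∀ i, 0 ≤ w i) (x y : Fin d → ℝ) :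
    ConvexOn ℝ Set.univ (lagrangian ν w x · y) := by
  refine ⟨convex_univ, fun z _ z' _ a b ha hb hab => ?_⟩
  have hterm : ∀ i, w i * ν i (a • z i + b • z' i) - scalarProduct (a • z i + b • z' i) y ≤
      a * (w i * ν i (z i) - scalarProduct (z i) y) +
        b * (w i * ν i (z' i) - scalarProduct (z' i) y) := fun i =>
    (((hν i).convexOn.smul (hw i)).sub
      (((dotProductBilin ℝ ℝ).flip y).concaveOn convex_univ)).2 trivial trivial ha hb hab
  simp only [lagrangian_eq, smul_eq_mul, mul_add, Finset.mul_sum]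
  have hsum := Finset.sum_le_sum fun i (_ : i ∈ Finset.univ) => hterm i
  rw [Finset.sum_add_distrib] at hsum
  have hx : scalarProduct x y = a * scalarProduct x y + b * scalarProduct x y := by
    rw [← add_mul, hab, one_mul]
  simp only [Pi.add_apply, Pi.smul_apply]
  linarith

theorem concaveOn_lagrangian (ν : ι → (Fin d → ℝ) → ℝ) (w : ι → ℝ) (x : Fin d → ℝ)
    (z : ι → Fin d → ℝ) : ConcaveOn ℝ Set.univ (lagrangian ν w x z) :=
  ((dotProductBilin ℝ ℝ (x - ∑ i, z i)).concaveOn convex_univ).add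
    (concaveOn_const _ convex_univ)

theorem exists_lt_lagrangian {t : ℝ}
    (ht : ∀ z ∈ unitDecompositions ν x, t < ∑ i, w i * ν i (z i)) {z : ι → Fin d → ℝ}
    (hz : ∑ i, ν i (z i) ≤ 1) : ∃ y, t < lagrangian ν w x z y := by
  rcases eq_or_ne (x - ∑ i, z i) 0 with hx | hx
  · refine ⟨0, ?_⟩
    simpa [lagrangian, hx, scalarProduct] using ht z ⟨hz, (sub_eq_zero.1 hx).symm⟩
  · obtain ⟨a, ha⟩ := exists_gt
      ((t - ∑ i, w i * ν i (z i)) / scalarProduct (x - ∑ i, z i) (x - ∑ i, z i))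
    rw [div_lt_iff₀ (scalarProduct_self_pos hx), sub_lt_iff_lt_add] at ha
    exact ⟨a • (x - ∑ i, z i), by rwa [lagrangian, scalarProduct_smul]⟩

theorem exists_forall_lt_lagrangian (hν : ∀ i, IsNorm (ν i)) (hw : ∀ i, 0 ≤ w i) {t : ℝ}
    (ht : ∀ z ∈ unitDecompositions ν x, t < ∑ i, w i * ν i (z i)) :
    ∃ y, ∀ z, ∑ i, ν i (z i) ≤ 1 → t < lagrangian ν w x z y := by
  have hconv : Convex ℝ {z : ι → Fin d → ℝ | ∑ i, ν i (z i) ≤ 1} := by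
    simpa using (IsNorm.sum hν).convexOn.convex_le 1
  obtain ⟨y, -, hy⟩ := exists_forall_lt_of_convexOn_of_concaveOn (f := lagrangian ν w x)
    ((IsNorm.sum hν).isCompact_le 1) ⟨0, (IsNorm.sum hν).map_zero.trans_le zero_le_one⟩
    (fun y _ => (convexOn_lagrangian hν hw x y).subset (Set.subset_univ _) hconv)
    (fun y _ => ((convexOn_lagrangian hν hw x y).continuousOn isOpen_univ).mono
      (Set.subset_univ _))
    (fun z _ => concaveOn_lagrangian ν w x z)
    (fun z _ => (concaveOn_lagrangian ν w x z).continuousOn isOpen_univ)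
    fun z hz => let ⟨y, hy⟩ := exists_lt_lagrangian ht hz; ⟨y, trivial, hy⟩
  exact ⟨y, hy⟩

theorem scalarProduct_sub_le_of_mem_unitDecompositions (hν : ∀ i, IsNorm (ν i))
    {y : Fin d → ℝ} {r : ℝ} (hr : 0 ≤ r) (hg : ∀ i, dualNorm (ν i) y - w i ≤ r)
    {z : ι → Fin d → ℝ} (hz : z ∈ unitDecompositions ν x) :
    scalarProduct x y - r ≤ ∑ i, w i * ν i (z i) := by
  obtain ⟨hz_le, rfl⟩ := hz
  have hterm : ∀ i, scalarProduct (z i) y ≤ w i * ν i (z i) + r * ν i (z i) := fun i =>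
    calc scalarProduct (z i) y ≤ ν i (z i) * dualNorm (ν i) y := (hν i).scalarProduct_le _ _
      _ ≤ ν i (z i) * (w i + r) :=
        mul_le_mul_of_nonneg_left (sub_le_iff_le_add'.1 (hg i)) ((hν i).nonneg _)
      _ = w i * ν i (z i) + r * ν i (z i) := by ring
  have hsum := Finset.sum_le_sum fun i (_ : i ∈ Finset.univ) => hterm i
  rw [Finset.sum_add_distrib, ← Finset.mul_sum] at hsum
  have hx : scalarProduct (∑ i, z i) y = ∑ i, scalarProduct (z i) y := sum_dotProduct _ _ _
  linarith [mul_le_of_le_one_right hr hz_le]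

theorem lt_scalarProduct_sub_of_forall_lt_lagrangian (hν : ∀ i, IsNorm (ν i)) (hw : ∀ i, 0 ≤ w i)
    {y : Fin d → ℝ} {t r : ℝ} (ht : ∀ z, ∑ i, ν i (z i) ≤ 1 → t < lagrangian ν w x z y)
    (hr : r = 0 ∨ ∃ i, dualNorm (ν i) y - w i = r) : t < scalarProduct x y - r := by
  classical
  rcases hr with rfl | ⟨i, rfl⟩
  · simpa [lagrangian, (hν _).map_zero] using ht 0 (by simp [(hν _).map_zero])
  · obtain ⟨b, hb, hby⟩ := (hν i).exists_dualNorm_eq y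
    have hsum : ∀ F : ι → (Fin d → ℝ) → ℝ, (∀ j, F j 0 = 0) →
        ∑ j, F j ((Pi.single i b : ι → Fin d → ℝ) j) = F i b := fun F hF => by
      rw [Fintype.sum_eq_single i fun j hj => by rw [Pi.single_eq_of_ne hj, hF], Pi.single_eq_same]
    have hlt := ht (Pi.single i b) ((hsum ν fun j => (hν j).map_zero).trans_le hb)
    rw [lagrangian_eq, hsum (fun j v => w j * ν j v - scalarProduct v y) fun j => by
      rw [(hν j).map_zero, zero_scalarProduct, mul_zero, sub_zero], hby] at hlt
    linarith [mul_le_of_le_one_right (hw i) hb]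

theorem isMinOver_unitDecompositions (hν : ∀ i, IsNorm (ν i)) (hw : ∀ i, 0 ≤ w i)
    (hg : ∀ y, IsGreatest (insert 0 (Set.range fun i => dualNorm (ν i) y - w i)) (g y))
    (x : Fin d → ℝ) :
    IsMinOver (unitDecompositions ν x) (fun z => ∑ i, w i * ν i (z i))
      (reverseFenchel (fun y => (g y : EReal)) x) := by
  refine .of_isCompact (IsNorm.isCompact_unitDecompositions hν x)
    (continuous_finsetSum _ fun i _ => continuous_const.mul
      ((hν i).continuous.comp (continuous_apply i))).continuousOn ?_
  rw [reverseFenchel, conjugate_coe]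
  refine le_antisymm ?_ (EReal.ge_of_forall_gt_iff_ge.1 fun t ht => ?_)
  · exact iSup_le fun y => le_iInf₂ fun z hz => EReal.coe_le_coe_iff.2 <|
      scalarProduct_sub_le_of_mem_unitDecompositions hν ((hg y).2 (Set.mem_insert _ _))
        (fun i => (hg y).2 (Set.mem_insert_of_mem _ ⟨i, rfl⟩)) hz
  · obtain ⟨y, hy⟩ := exists_forall_lt_lagrangian (w := w) hν hw fun z hz =>
      EReal.coe_lt_coe_iff.1 (ht.trans_le (iInf₂_le z hz))
    exact (EReal.coe_le_coe_iff.2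
      (lt_scalarProduct_sub_of_forall_lt_lagrangian hν hw hy (hg y).1).le).trans
        (le_iSup (fun y => ((scalarProduct x y - g y : ℝ) : EReal)) y)

end UnitDecompositions

section SupportNorms

variable {d k l : ℕ} {N : (Fin d → ℝ) → ℝ} {K : Finset (Fin d)} {x : Fin d → ℝ}

theorem restrict_add (K : Finset (Fin d)) (x y : Fin d → ℝ) :
    restrict K (x + y) = restrict K x + restrict K y :=
  funext fun i => by by_cases hi : i ∈ K <;> simp [restrict, hi]

theorem restrict_smul (K : Finset (Fin d)) (a : ℝ) (x : Fin d → ℝ) :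
    restrict K (a • x) = a • restrict K x :=
  funext fun i => by by_cases hi : i ∈ K <;> simp [restrict, hi]

theorem restrict_eq_self_iff : restrict K x = x ↔ ∀ i, x i ≠ 0 → i ∈ K := by
  simp only [funext_iff, restrict, ite_eq_left_iff, eq_comm (a := (0 : ℝ)), not_imp_comm]

theorem restrict_support (x : Fin d → ℝ) :
    restrict (Finset.univ.filter fun i => x i ≠ 0) x = x :=
  restrict_eq_self_iff.2 fun i hi => by simpa using hi

theorem scalarProduct_restrict (K : Finset (Fin d)) (x y : Fin d → ℝ) :
    scalarProduct x (restrict K y) = scalarProduct (restrict K x) y := by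
  simp only [scalarProduct, dotProduct, restrict, mul_ite, ite_mul, mul_zero, zero_mul]

theorem lzero_restrict_le (K : Finset (Fin d)) (x : Fin d → ℝ) :
    (lzero (restrict K x) : ℕ) ≤ K.card := by
  change (Finset.univ.filter fun i => restrict K x i ≠ 0).card ≤ K.card
  refine Finset.card_le_card fun i hi => ?_
  by_contra hK
  simp [restrict, hK] at hi

theorem lzero_zero : lzero (0 : Fin d → ℝ) = 0 := by
  simp [lzero]

theorem lzero_smul {a : ℝ} (ha : a ≠ 0) (x : Fin d → ℝ) : lzero (a • x) = lzero x := by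
  simp [lzero, ha]

theorem OrthantStrictlyMonotonic.restrict_lt (hmono : OrthantStrictlyMonotonic N)
    (hx : restrict K x ≠ x) : N (restrict K x) < N x := by
  obtain ⟨i, hxi, hi⟩ : ∃ i, x i ≠ 0 ∧ i ∉ K := by
    simpa only [Ne, restrict_eq_self_iff, not_forall, exists_prop] using hx
  refine hmono _ _ (fun j => ?_) ⟨i, by simpa [restrict, hi] using hxi⟩ fun j => ?_
  all_goals by_cases hj : j ∈ K <;> simp [restrict, hj, mul_self_nonneg]

theorem OrthantStrictlyMonotonic.restrict_le (hmono : OrthantStrictlyMonotonic N)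
    (K : Finset (Fin d)) (x : Fin d → ℝ) : N (restrict K x) ≤ N x := by
  by_cases hx : restrict K x = x
  · rw [hx]
  · exact (hmono.restrict_lt hx).le

theorem dualNorm_restrict_le_topDualNorm (hK : K.card ≤ k) (y : Fin d → ℝ) :
    dualNorm N (restrict K y) ≤ topDualNorm N k y :=
  le_ciSup (f := fun K : {K : Finset (Fin d) // K.card ≤ k} => dualNorm N (restrict K.1 y))
    (Set.finite_range _).bddAbove ⟨K, hK⟩

theorem exists_topDualNorm_eq (N : (Fin d → ℝ) → ℝ) (k : ℕ) (y : Fin d → ℝ) :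
    ∃ K : Finset (Fin d), K.card ≤ k ∧ dualNorm N (restrict K y) = topDualNorm N k y := by
  have : Nonempty {K : Finset (Fin d) // K.card ≤ k} := ⟨⟨∅, by simp⟩⟩
  obtain ⟨K, hK⟩ := exists_eq_ciSup_of_finite
    (f := fun K : {K : Finset (Fin d) // K.card ≤ k} => dualNorm N (restrict K.1 y))
  exact ⟨K.1, K.2, hK⟩

theorem topDualNorm_mono (hkl : k ≤ l) (y : Fin d → ℝ) :
    topDualNorm N k y ≤ topDualNorm N l y := by
  obtain ⟨K, hK, hKy⟩ := exists_topDualNorm_eq N k y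
  exact hKy ▸ dualNorm_restrict_le_topDualNorm (hK.trans hkl) y

theorem topDualNorm_zero (hN : IsNorm N) (y : Fin d → ℝ) : topDualNorm N 0 y = 0 := by
  obtain ⟨K, hK, hKy⟩ := exists_topDualNorm_eq N 0 y
  have hempty : restrict K y = 0 := by
    rw [Finset.card_eq_zero.1 (Nat.le_zero.1 hK)]
    rfl
  rw [← hKy, hempty, hN.dual.map_zero]

theorem topDualNorm_self (hmono_dual : OrthantStrictlyMonotonic (dualNorm N)) :
    topDualNorm N d = dualNorm N := by
  funext y
  refine le_antisymm ?_ ?_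
  · obtain ⟨K, -, hK⟩ := exists_topDualNorm_eq N d y
    exact hK ▸ hmono_dual.restrict_le K y
  · have huniv : restrict Finset.univ y = y := restrict_eq_self_iff.2 fun i _ => Finset.mem_univ i
    calc dualNorm N y = dualNorm N (restrict Finset.univ y) := by rw [huniv]
      _ ≤ topDualNorm N d y := dualNorm_restrict_le_topDualNorm (Finset.card_fin d).le y

theorem topDualNorm_smul (hN : IsNorm N) (k : ℕ) (a : ℝ) (y : Fin d → ℝ) :
    topDualNorm N k (a • y) = |a| * topDualNorm N k y := by
  simp only [topDualNorm, restrict_smul, hN.dual.smul_eq]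
  exact (Real.mul_iSup_of_nonneg (abs_nonneg a) _).symm

theorem topDualNorm_add_le (hN : IsNorm N) (k : ℕ) (x y : Fin d → ℝ) :
    topDualNorm N k (x + y) ≤ topDualNorm N k x + topDualNorm N k y := by
  obtain ⟨K, hK, hKxy⟩ := exists_topDualNorm_eq N k (x + y)
  rw [← hKxy, restrict_add]
  exact (hN.dual.add_le _ _).trans (add_le_add (dualNorm_restrict_le_topDualNorm hK x)
    (dualNorm_restrict_le_topDualNorm hK y))

theorem isNorm_topDualNorm (hN : IsNorm N) (k : ℕ) : IsNorm (topDualNorm N (k + 1)) where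
  exists_seminorm_eq :=
    ⟨.of _ (topDualNorm_add_le hN (k + 1)) (topDualNorm_smul hN (k + 1)), rfl⟩
  eq_zero_of_map_eq_zero x hx := by
    funext i
    have hle : dualNorm N (restrict {i} x) ≤ 0 :=
      hx ▸ dualNorm_restrict_le_topDualNorm (k := k + 1) (by simp) x
    have hzero := hN.dual.eq_zero_of_map_eq_zero _ (hle.antisymm (hN.dual.nonneg _))
    simpa [restrict] using congrFun hzero i

theorem supportDualNorm_succ (N : (Fin d → ℝ) → ℝ) (k : ℕ) :
    supportDualNorm N (k + 1) = dualNorm (topDualNorm N (k + 1)) :=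
  if_neg k.succ_ne_zero

theorem isNorm_supportDualNorm (hN : IsNorm N) (k : ℕ) : IsNorm (supportDualNorm N (k + 1)) :=
  supportDualNorm_succ N k ▸ (isNorm_topDualNorm hN k).dual

theorem dualNorm_supportDualNorm (hN : IsNorm N) (k : ℕ) :
    dualNorm (supportDualNorm N (k + 1)) = topDualNorm N (k + 1) := by
  rw [supportDualNorm_succ, (isNorm_topDualNorm hN k).dualNorm_dualNorm]

theorem mem_supportBall_succ : x ∈ supportBall N (k + 1) ↔ supportDualNorm N (k + 1) x ≤ 1 := by
  simp [supportBall]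

theorem mem_supportSphere_succ :
    x ∈ supportSphere N (k + 1) ↔ supportDualNorm N (k + 1) x = 1 := by
  simp [supportSphere]

theorem supportSphere_subset_supportBall (N : (Fin d → ℝ) → ℝ) (k : ℕ) :
    supportSphere N k ⊆ supportBall N k := by
  cases k with
  | zero => simp [supportSphere, supportBall]
  | succ k => exact fun x hx => mem_supportBall_succ.2 (mem_supportSphere_succ.1 hx).le

theorem mem_supportBall_iff (hN : IsNorm N) :
    x ∈ supportBall N k ↔ ∀ y, scalarProduct x y ≤ topDualNorm N k y := by
  cases k with
  | zero =>
    simp only [supportBall, if_true, Set.mem_singleton_iff, topDualNorm_zero hN]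
    refine ⟨?_, fun h => ?_⟩
    · rintro rfl y
      exact (zero_scalarProduct y).le
    · by_contra hx
      exact (scalarProduct_self_pos hx).not_ge (h x)
  | succ k =>
    rw [mem_supportBall_succ, supportDualNorm_succ, (isNorm_topDualNorm hN k).dualNorm_le_one_iff]

theorem supportBall_mono (hN : IsNorm N) : Monotone (supportBall N) := fun _ _ hkl _ hx =>
  (mem_supportBall_iff hN).2 fun y =>
    ((mem_supportBall_iff hN).1 hx y).trans (topDualNorm_mono hkl y)

theorem supportBall_self (hN : IsNorm N) (hmono_dual : OrthantStrictlyMonotonic (dualNorm N)) :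
    supportBall N d = {x | N x ≤ 1} := by
  ext x
  rw [mem_supportBall_iff hN, topDualNorm_self hmono_dual, ← hN.dual.dualNorm_le_one_iff,
    hN.dualNorm_dualNorm, Set.mem_ofPred_eq]

theorem exists_sparse_topDualNorm_eq (hN : IsNorm N) (hmono : OrthantStrictlyMonotonic N) (k : ℕ)
    (y : Fin d → ℝ) :
    ∃ x, N x ≤ 1 ∧ (lzero x : ℕ) ≤ k ∧ scalarProduct x y = topDualNorm N k y := by
  obtain ⟨K, hK, hKy⟩ := exists_topDualNorm_eq N k y
  obtain ⟨x, hx, hxy⟩ := hN.exists_dualNorm_eq (restrict K y)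
  exact ⟨restrict K x, (hmono.restrict_le K x).trans hx, (lzero_restrict_le K x).trans hK,
    by rw [← scalarProduct_restrict, hxy, hKy]⟩

theorem scalarProduct_le_topDualNorm_lzero (hN : IsNorm N) (hx : N x ≤ 1) (y : Fin d → ℝ) :
    scalarProduct x y ≤ topDualNorm N (lzero x) y := by
  rw [← restrict_support x, ← scalarProduct_restrict, restrict_support x]
  exact (hN.scalarProduct_le_dualNorm hx _).trans (dualNorm_restrict_le_topDualNorm le_rfl y)

end SupportNorms

section CapraConjugate

variable {d : ℕ} {N : (Fin d → ℝ) → ℝ} {φ : Fin (d + 1) → ℝ} {x y : Fin d → ℝ}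

theorem coupling_eq_comp (N : (Fin d → ℝ) → ℝ) :
    coupling N = scalarProduct ∘ normalization N := by
  funext x y
  by_cases hx : x = 0
  · simp [coupling, normalization, hx, zero_scalarProduct]
  · simp [coupling, normalization, hx, smul_scalarProduct, div_eq_inv_mul]

theorem calL_eq_conjugate (N : (Fin d → ℝ) → ℝ) (φ : Fin (d + 1) → ℝ) :
    calL N φ = conjugate (flip scalarProduct)
      (conjugate (scalarProduct ∘ normalization N) (phiLzero φ)) := by
  rw [← coupling_eq_comp]
  rfl

theorem isConvex_calL (N : (Fin d → ℝ) → ℝ) (φ : Fin (d + 1) → ℝ) : IsConvex (calL N φ) :=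
  isConvex_conjugate convexOn_scalarProduct _

theorem lowerSemicontinuous_calL (N : (Fin d → ℝ) → ℝ) (φ : Fin (d + 1) → ℝ) :
    LowerSemicontinuous (calL N φ) :=
  lowerSemicontinuous_conjugate continuous_scalarProduct _

theorem calL_comp_normalization_le (N : (Fin d → ℝ) → ℝ) (φ : Fin (d + 1) → ℝ) :
    calL N φ ∘ normalization N ≤ phiLzero φ := by
  rw [calL_eq_conjugate]
  exact conjugate_flip_conjugate_comp_le _ _ _

theorem conjugate_scalarProduct_calL (N : (Fin d → ℝ) → ℝ) (φ : Fin (d + 1) → ℝ) :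
    conjugate scalarProduct (calL N φ) = conjugate (coupling N) (phiLzero φ) := by
  rw [calL_eq_conjugate, conjugate_conjugate_flip_conjugate_comp, coupling_eq_comp]

/-- The Capra-conjugate of `φ ∘ ℓ₀`, in closed form: see `conjugate_coupling_phiLzero`. -/
noncomputable def capraConjugate (N : (Fin d → ℝ) → ℝ) (φ : Fin (d + 1) → ℝ) (y : Fin d → ℝ) : ℝ :=
  ⨆ l : Fin (d + 1), (topDualNorm N l y - φ l)

theorem isGreatest_capraConjugate (N : (Fin d → ℝ) → ℝ) (φ : Fin (d + 1) → ℝ) (y : Fin d → ℝ) :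
    IsGreatest (Set.range fun l : Fin (d + 1) => topDualNorm N l y - φ l)
      (capraConjugate N φ y) :=
  ⟨exists_eq_ciSup_of_finite, Set.forall_mem_range.2 (le_ciSup (Set.finite_range _).bddAbove)⟩

theorem topDualNorm_sub_le_capraConjugate (N : (Fin d → ℝ) → ℝ) (φ : Fin (d + 1) → ℝ)
    (y : Fin d → ℝ) (l : Fin (d + 1)) : topDualNorm N l y - φ l ≤ capraConjugate N φ y :=
  (isGreatest_capraConjugate N φ y).2 ⟨l, rfl⟩

theorem coe_capraConjugate (N : (Fin d → ℝ) → ℝ) (φ : Fin (d + 1) → ℝ) (y : Fin d → ℝ) :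
    (capraConjugate N φ y : EReal) =
      ⨆ l : Fin (d + 1), ((topDualNorm N l y - φ l : ℝ) : EReal) := by
  simpa only [sSup_image, iSup_range] using
    (EReal.coe_strictMono.monotone.map_isGreatest (isGreatest_capraConjugate N φ y)).csSup_eq.symm

theorem IsNorm.normalization_le_one (hN : IsNorm N) (x : Fin d → ℝ) :
    N (normalization N x) ≤ 1 := by
  by_cases hx : x = 0
  · simp [normalization, hx, hN.map_zero]
  · simp [normalization, hx, hN.map_inv_smul_self hx]

theorem IsNorm.lzero_normalization (hN : IsNorm N) (x : Fin d → ℝ) :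
    lzero (normalization N x) = lzero x := by
  by_cases hx : x = 0
  · simp [normalization, hx]
  · rw [normalization, if_neg hx, lzero_smul (inv_ne_zero (hN.pos hx).ne')]

theorem coupling_le_topDualNorm_lzero (hN : IsNorm N) (x y : Fin d → ℝ) :
    coupling N x y ≤ topDualNorm N (lzero x) y := by
  rw [coupling_eq_comp, ← hN.lzero_normalization]
  exact scalarProduct_le_topDualNorm_lzero hN (hN.normalization_le_one x) y

theorem exists_topDualNorm_le_coupling (hN : IsNorm N) (hmono : OrthantStrictlyMonotonic N) (k : ℕ)
    (y : Fin d → ℝ) : ∃ x, (lzero x : ℕ) ≤ k ∧ topDualNorm N k y ≤ coupling N x y := by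
  obtain ⟨x, hx, hxk, hxy⟩ := exists_sparse_topDualNorm_eq hN hmono k y
  refine ⟨x, hxk, ?_⟩
  rw [← hxy, coupling]
  split_ifs with hx0
  · rw [hx0, zero_scalarProduct]
  · have hnonneg : 0 ≤ scalarProduct x y :=
      hxy ▸ topDualNorm_zero hN y ▸ topDualNorm_mono k.zero_le y
    exact le_div_self hnonneg (hN.pos hx0) hx

theorem conjugate_coupling_phiLzero (hN : IsNorm N) (hmono : OrthantStrictlyMonotonic N)
    (hφ : Monotone φ) (y : Fin d → ℝ) :
    conjugate (coupling N) (phiLzero φ) y = capraConjugate N φ y := by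
  refine (conjugate_coe _ _ y).trans (le_antisymm (iSup_le fun x => ?_) ?_)
  · exact EReal.coe_le_coe_iff.2 ((sub_le_sub_right (coupling_le_topDualNorm_lzero hN x y) _).trans
      (topDualNorm_sub_le_capraConjugate N φ y (lzero x)))
  · obtain ⟨l, hl⟩ := (isGreatest_capraConjugate N φ y).1
    obtain ⟨x, hxl, hxy⟩ := exists_topDualNorm_le_coupling hN hmono l y
    exact (EReal.coe_le_coe_iff.2 (hl.ge.trans (sub_le_sub hxy (hφ hxl)))).trans
      (le_iSup (fun x => ((coupling N x y - φ (lzero x) : ℝ) : EReal)) x)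

theorem calL_eq_reverseFenchel (hN : IsNorm N) (hmono : OrthantStrictlyMonotonic N)
    (hφ : Monotone φ) : calL N φ = reverseFenchel fun y => (capraConjugate N φ y : EReal) :=
  congrArg reverseFenchel (funext (conjugate_coupling_phiLzero hN hmono hφ))

theorem coe_le_calL (hN : IsNorm N) (hmono : OrthantStrictlyMonotonic N) (hφ : Monotone φ)
    (x y : Fin d → ℝ) :
    ((scalarProduct x y - capraConjugate N φ y : ℝ) : EReal) ≤ calL N φ x := by
  rw [calL_eq_reverseFenchel hN hmono hφ, reverseFenchel, conjugate_coe]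
  exact le_iSup (fun y => ((scalarProduct x y - capraConjugate N φ y : ℝ) : EReal)) y

theorem capraConjugate_zero (hN : IsNorm N) (hφ : Monotone φ) (hφ_zero : φ 0 = 0) :
    capraConjugate N φ 0 = 0 := by
  have htop : ∀ k, topDualNorm N k 0 = 0 := fun k => by
    simpa using topDualNorm_smul hN k 0 (0 : Fin d → ℝ)
  refine (isGreatest_capraConjugate N φ 0).unique ⟨⟨0, by simp [htop, hφ_zero]⟩, ?_⟩
  rintro _ ⟨l, rfl⟩
  simpa [htop] using hφ_zero ▸ hφ (Fin.zero_le l)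

theorem calL_nonneg (hN : IsNorm N) (hmono : OrthantStrictlyMonotonic N) (hφ : Monotone φ)
    (hφ_zero : φ 0 = 0) (x : Fin d → ℝ) : 0 ≤ calL N φ x := by
  simpa [capraConjugate_zero hN hφ hφ_zero, scalarProduct] using coe_le_calL hN hmono hφ x 0

theorem calL_le_of_mem_supportBall (hN : IsNorm N) (hmono : OrthantStrictlyMonotonic N)
    (hφ : Monotone φ) {l : Fin (d + 1)} (hx : x ∈ supportBall N l) : calL N φ x ≤ φ l := by
  rw [calL_eq_reverseFenchel hN hmono hφ]
  refine conjugate_le_coe_iff.2 fun y => EReal.coe_le_coe_iff.2 ?_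
  exact (sub_le_sub_right ((mem_supportBall_iff hN).1 hx y) _).trans
    (topDualNorm_sub_le_capraConjugate N φ y l)

theorem calL_zero (hN : IsNorm N) (hmono : OrthantStrictlyMonotonic N) (hφ : Monotone φ)
    (hφ_zero : φ 0 = 0) : calL N φ 0 = 0 := by
  refine le_antisymm ?_ (calL_nonneg hN hmono hφ hφ_zero 0)
  simpa [hφ_zero] using
    calL_le_of_mem_supportBall hN hmono hφ (x := 0) (l := 0) (by simp [supportBall])

theorem isProper_calL (hN : IsNorm N) (hmono : OrthantStrictlyMonotonic N) (hφ : Monotone φ)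
    (hφ_zero : φ 0 = 0) : IsProper (calL N φ) :=
  ⟨fun x => (EReal.bot_lt_zero.trans_le (calL_nonneg hN hmono hφ hφ_zero x)).ne',
    0, by simp [calL_zero hN hmono hφ hφ_zero]⟩

end CapraConjugate

section Factorization

variable {d k : ℕ} {N : (Fin d → ℝ) → ℝ} {φ : Fin (d + 1) → ℝ} {x y : Fin d → ℝ}

theorem exists_norming_same_support (hN : IsNorm N) (hmono : OrthantStrictlyMonotonic N)
    (hmono_dual : OrthantStrictlyMonotonic (dualNorm N)) (hx : x ≠ 0) :
    ∃ y, dualNorm N y ≤ 1 ∧ scalarProduct x y = N x ∧ ∀ i, y i ≠ 0 ↔ x i ≠ 0 := by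
  obtain ⟨z, hz, hxz⟩ := hN.exists_norming hx
  set y := restrict (Finset.univ.filter fun i => x i ≠ 0) z with hy
  have hy_le : dualNorm N y ≤ 1 := (hmono_dual.restrict_le _ z).trans hz
  have hxy : scalarProduct x y = N x := by
    rw [hy, scalarProduct_restrict, restrict_support, hxz]
  refine ⟨y, hy_le, hxy, fun i => ⟨fun hyi hxi => hyi (by simp [hy, restrict, hxi]), ?_⟩⟩
  -- `y` only sees the restriction of `x` to the support of `y`, which thus has the norm of `x`.
  set K := Finset.univ.filter fun i => y i ≠ 0 with hK
  have hle : N x ≤ N (restrict K x) := by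
    calc N x = scalarProduct (restrict K x) y := by
          rw [← scalarProduct_restrict, restrict_support, hxy]
      _ ≤ N (restrict K x) * dualNorm N y := hN.scalarProduct_le _ _
      _ ≤ N (restrict K x) := mul_le_of_le_one_right (hN.nonneg _) hy_le
  have hKx : restrict K x = x := by
    by_contra hne
    exact (hmono.restrict_lt hne).not_ge hle
  simpa [hK] using restrict_eq_self_iff.1 hKx i

theorem topDualNorm_le_dualNorm (hmono_dual : OrthantStrictlyMonotonic (dualNorm N)) (hk : k ≤ d)
    (y : Fin d → ℝ) : topDualNorm N k y ≤ dualNorm N y :=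
  topDualNorm_self hmono_dual ▸ topDualNorm_mono hk y

theorem topDualNorm_lt_dualNorm (hmono_dual : OrthantStrictlyMonotonic (dualNorm N))
    (hk : k < (lzero y : ℕ)) : topDualNorm N k y < dualNorm N y := by
  obtain ⟨K, hK, hKy⟩ := exists_topDualNorm_eq N k y
  rw [← hKy]
  refine hmono_dual.restrict_lt fun heq => hk.not_ge ?_
  rw [← heq]
  exact (lzero_restrict_le K y).trans hK

theorem eventually_capraConjugate_smul_le (hN : IsNorm N)
    (hmono_dual : OrthantStrictlyMonotonic (dualNorm N)) (hφ : Monotone φ) (hy : dualNorm N y ≤ 1) :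
    ∀ᶠ m : ℝ in Filter.atTop, capraConjugate N φ (m • y) ≤ m - φ (lzero y) := by
  have hterm : ∀ l : Fin (d + 1), ∀ᶠ m : ℝ in Filter.atTop,
      m * topDualNorm N l y - φ l ≤ m - φ (lzero y) := fun l => by
    rcases lt_or_ge l (lzero y) with hl | hl
    · have hlt : 0 < 1 - topDualNorm N l y :=
        sub_pos.2 ((topDualNorm_lt_dualNorm hmono_dual hl).trans_le hy)
      filter_upwards [Filter.eventually_ge_atTop
        ((φ (lzero y) - φ l) / (1 - topDualNorm N l y))] with m hm
      rw [div_le_iff₀ hlt] at hm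
      linarith
    · have hle : topDualNorm N l y ≤ 1 := (topDualNorm_le_dualNorm hmono_dual l.is_le y).trans hy
      filter_upwards [Filter.eventually_ge_atTop 0] with m hm
      exact sub_le_sub (mul_le_of_le_one_right hm hle) (hφ hl)
  filter_upwards [Filter.eventually_all.2 hterm, Filter.eventually_ge_atTop 0] with m hle hm
  refine ciSup_le fun l => ?_
  rw [topDualNorm_smul hN, abs_of_nonneg hm]
  exact hle l

theorem phiLzero_le_calL_normalization (hN : IsNorm N) (hmono : OrthantStrictlyMonotonic N)
    (hmono_dual : OrthantStrictlyMonotonic (dualNorm N)) (hφ : Monotone φ) (hx : x ≠ 0) :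
    phiLzero φ x ≤ calL N φ (normalization N x) := by
  obtain ⟨y, hy, hxy, hsupp⟩ := exists_norming_same_support hN hmono hmono_dual hx
  have hlzero : lzero y = lzero x := by simp only [lzero, hsupp]
  obtain ⟨m, hm⟩ := (eventually_capraConjugate_smul_le hN hmono_dual hφ hy).exists
  have hpair : scalarProduct (normalization N x) (m • y) = m := by
    rw [normalization, if_neg hx, smul_scalarProduct, scalarProduct_smul, hxy, mul_left_comm,
      inv_mul_cancel₀ (hN.pos hx).ne', mul_one]
  refine le_trans (EReal.coe_le_coe_iff.2 ?_) (coe_le_calL hN hmono hφ (normalization N x) (m • y))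
  rw [hpair, ← hlzero]
  linarith

theorem phiLzero_eq_calL_comp_normalization (hN : IsNorm N) (hmono : OrthantStrictlyMonotonic N)
    (hmono_dual : OrthantStrictlyMonotonic (dualNorm N)) (hφ : Monotone φ) (hφ_zero : φ 0 = 0) :
    phiLzero φ = calL N φ ∘ normalization N := by
  refine le_antisymm (fun x => ?_) (calL_comp_normalization_le N φ)
  rcases eq_or_ne x 0 with rfl | hx
  · simp [normalization, calL_zero hN hmono hφ hφ_zero, phiLzero, lzero_zero, hφ_zero]
  · exact phiLzero_le_calL_normalization hN hmono hmono_dual hφ hx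

theorem normalization_eq_self (hx : N x = 1) : normalization N x = x := by
  rw [normalization, hx, inv_one, one_smul]
  exact ite_eq_right_iff.2 Eq.symm

theorem phiLzero_eq_calL (hN : IsNorm N) (hmono : OrthantStrictlyMonotonic N)
    (hmono_dual : OrthantStrictlyMonotonic (dualNorm N)) (hφ : Monotone φ) (hφ_zero : φ 0 = 0)
    (hx : N x = 1) : phiLzero φ x = calL N φ x := by
  rw [phiLzero_eq_calL_comp_normalization hN hmono hmono_dual hφ hφ_zero, Function.comp_apply,
    normalization_eq_self hx]

theorem subdifferential_coupling_eq (hN : IsNorm N) (hmono : OrthantStrictlyMonotonic N)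
    (hmono_dual : OrthantStrictlyMonotonic (dualNorm N)) (hφ : Monotone φ) (hφ_zero : φ 0 = 0)
    (hx : N x = 1) :
    subdifferential (coupling N) (phiLzero φ) x = subdifferential scalarProduct (calL N φ) x := by
  have hcoupling : coupling N x = scalarProduct x := by
    rw [coupling_eq_comp, Function.comp_apply, normalization_eq_self hx]
  simp only [subdifferential, conjugate_scalarProduct_calL, hcoupling,
    phiLzero_eq_calL hN hmono hmono_dual hφ hφ_zero hx]

end Factorization

section StepFunction

variable {d : ℕ} {φ : Fin (d + 1) → ℝ} {B : ℕ → Set (Fin d → ℝ)} {x : Fin d → ℝ}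
  {l : Fin (d + 1)}

theorem le_stepFunction_iff {a : EReal} :
    a ≤ stepFunction B φ x ↔ ∀ l : Fin (d + 1), x ∈ B l → a ≤ (φ l : EReal) := by
  rw [stepFunction, le_iInf_iff]
  refine forall_congr' fun l => ?_
  by_cases hx : x ∈ B l <;> simp [indicator, hx]

theorem stepFunction_le (hx : x ∈ B l) : stepFunction B φ x ≤ (φ l : EReal) :=
  le_stepFunction_iff.1 le_rfl l hx

theorem stepFunction_eq_sInf (B : ℕ → Set (Fin d → ℝ)) (φ : Fin (d + 1) → ℝ) (x : Fin d → ℝ) :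
    stepFunction B φ x = sInf ((fun l : Fin (d + 1) => (φ l : EReal)) '' {l | x ∈ B l}) :=
  eq_of_forall_le_iff fun a => by simp [le_stepFunction_iff, sInf_image]

theorem stepFunction_eq_of_mem_of_forall_lt (hφ : Monotone φ) (hx : x ∈ B l)
    (hlt : ∀ k < l, x ∉ B k) : stepFunction B φ x = (φ l : EReal) :=
  (stepFunction_le hx).antisymm <| le_stepFunction_iff.2 fun _ hk =>
    EReal.coe_le_coe_iff.2 (hφ (not_lt.1 fun hkl => hlt _ hkl hk))

theorem stepFunction_supportBall_of_mem_diff {N : (Fin d → ℝ) → ℝ} (hN : IsNorm N)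
    (hφ : Monotone φ) {l : Fin d} (hx : x ∈ supportBall N (l + 1) \ supportBall N l) :
    stepFunction (supportBall N) φ x = (φ l.succ : EReal) :=
  stepFunction_eq_of_mem_of_forall_lt hφ hx.1 fun _ hk hxk =>
    hx.2 (supportBall_mono hN (Nat.lt_succ_iff.1 hk) hxk)

theorem stepFunction_supportBall_zero (N : (Fin d → ℝ) → ℝ) (hφ : Monotone φ)
    (hφ_zero : φ 0 = 0) : stepFunction (supportBall N) φ 0 = 0 := by
  simpa [hφ_zero] using stepFunction_eq_of_mem_of_forall_lt (B := supportBall N) (x := 0) (l := 0)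
    hφ (by simp [supportBall]) (by simp)

theorem stepFunction_supportBall_eq_top {N : (Fin d → ℝ) → ℝ} (hN : IsNorm N)
    (hx : x ∉ supportBall N d) : stepFunction (supportBall N) φ x = ⊤ :=
  top_le_iff.1 (le_stepFunction_iff.2 fun l hl => absurd (supportBall_mono hN l.is_le hl) hx)

theorem IsConvex.le_sum_of_mem_simplexFeasible {f : (Fin d → ℝ) → EReal} (hf : IsConvex f)
    (hfB : f ≤ stepFunction B φ) (hB : 0 ∈ B 0) (hφ_zero : φ 0 = 0) {w : Fin (d + 1) → ℝ}
    (hw : w ∈ simplexFeasible B x) : f x ≤ (∑ l : Fin d, w l.succ * φ l.succ : ℝ) := by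
  obtain ⟨⟨hw_nonneg, hw_sum⟩, hx⟩ := hw
  obtain ⟨z, hz, hzx⟩ := (Set.mem_fintype_sum _ _).1 hx
  choose b hb hbz using hz
  let p : Fin (d + 1) → (Fin d → ℝ) × ℝ := Fin.cons (0, 0) fun l => (b l, φ l.succ)
  have hp : ∀ l, f (p l).1 ≤ ((p l).2 : EReal) := fun l => by
    induction l using Fin.cases with
    | zero => simpa [p, hφ_zero] using (hfB 0).trans (stepFunction_le (l := 0) hB)
    | succ l => exact (hfB (b l)).trans (stepFunction_le (l := l.succ) (hb l))
  have hp_sum : ∑ l, w l • p l = (x, ∑ l : Fin d, w l.succ * φ l.succ) := by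
    rw [Fin.sum_univ_succ]
    refine Prod.ext ?_ ?_
    · simpa [p, Prod.fst_sum, ← hzx] using Finset.sum_congr rfl fun l _ => hbz l
    · simp [p, Prod.snd_sum]
  have hmem := hf.sum_mem (fun l _ => hw_nonneg l) hw_sum fun l _ => hp l
  rwa [hp_sum] at hmem

theorem isLargestConvexLscBelow_stepFunction {L : (Fin d → ℝ) → EReal} (hL : IsConvex L)
    (hL_lsc : LowerSemicontinuous L) (hLB : L ≤ stepFunction B φ) (hB : 0 ∈ B 0)
    (hφ_zero : φ 0 = 0)
    (hL_eq : ∀ x, L x =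
      ⨅ w ∈ simplexFeasible B x, ((∑ l : Fin d, w l.succ * φ l.succ : ℝ) : EReal)) :
    IsLargestConvexLscBelow L (stepFunction B φ) :=
  ⟨⟨hL, hL_lsc, hLB⟩, fun _ hf x => (hL_eq x).symm ▸ le_iInf₂ fun _ hw =>
    hf.1.le_sum_of_mem_simplexFeasible hf.2.2 hB hφ_zero hw⟩

end StepFunction

section Minima

variable {d : ℕ} {N : (Fin d → ℝ) → ℝ} {φ : Fin (d + 1) → ℝ} {x : Fin d → ℝ}

theorem isMinOver_decompositions (hN : IsNorm N) (hmono : OrthantStrictlyMonotonic N)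
    (hφ : Monotone φ) (hφ_zero : φ 0 = 0) (x : Fin d → ℝ) :
    IsMinOver (decompositions N x)
      (fun z => ∑ l : Fin d, φ l.succ * supportDualNorm N (l + 1) (z l)) (calL N φ x) := by
  rw [calL_eq_reverseFenchel hN hmono hφ]
  refine isMinOver_unitDecompositions (fun l : Fin d => isNorm_supportDualNorm hN l)
    (fun l => hφ_zero ▸ hφ (Fin.zero_le l.succ)) (fun y => ?_) x
  have hzero : topDualNorm N ((0 : Fin (d + 1)) : ℕ) y - φ 0 = 0 := by
    simp [topDualNorm_zero hN, hφ_zero]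
  have hgreatest := isGreatest_capraConjugate N φ y
  rw [Fin.range_fin_succ, hzero] at hgreatest
  simp only [dualNorm_supportDualNorm hN]
  exact hgreatest

theorem simplexFeasible_mono {B C : ℕ → Set (Fin d → ℝ)} (h : ∀ l, B l ⊆ C l) (x : Fin d → ℝ) :
    simplexFeasible B x ⊆ simplexFeasible C x := fun _ ⟨hw, hx⟩ =>
  ⟨hw, Set.finsetSum_subset_finsetSum _ _ _ (fun _ _ => Set.smul_set_mono (h _)) hx⟩

theorem exists_mem_simplexFeasible_supportSphere [NeZero d] (hN : IsNorm N) {z : Fin d → Fin d → ℝ}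
    (hz : z ∈ decompositions N x) :
    ∃ w ∈ simplexFeasible (supportSphere N) x,
      ∀ l : Fin d, w l.succ = supportDualNorm N (l + 1) (z l) := by
  refine ⟨Fin.cons (1 - ∑ l : Fin d, supportDualNorm N (l + 1) (z l))
    fun l => supportDualNorm N (l + 1) (z l), ⟨⟨fun l => ?_, ?_⟩, ?_⟩, fun l => rfl⟩
  · induction l using Fin.cases with
    | zero => exact sub_nonneg.2 hz.1
    | succ l => exact (isNorm_supportDualNorm hN l).nonneg (z l)
  · simp [Fin.sum_univ_succ]
  · refine (Set.mem_fintype_sum _ _).2 ⟨z, fun l => ?_, hz.2⟩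
    obtain ⟨u, hu, huz⟩ := (isNorm_supportDualNorm hN l).exists_smul_eq (z l)
    exact ⟨u, mem_supportSphere_succ.2 hu, huz⟩

theorem exists_mem_decompositions_of_mem_simplexFeasible (hN : IsNorm N) {w : Fin (d + 1) → ℝ}
    (hw : w ∈ simplexFeasible (supportBall N) x) :
    ∃ z ∈ decompositions N x, ∀ l : Fin d, supportDualNorm N (l + 1) (z l) ≤ w l.succ := by
  obtain ⟨⟨hw_nonneg, hw_sum⟩, hx⟩ := hw
  obtain ⟨z, hz, hzx⟩ := (Set.mem_fintype_sum _ _).1 hx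
  have hle : ∀ l : Fin d, supportDualNorm N (l + 1) (z l) ≤ w l.succ := fun l => by
    obtain ⟨b, hb, hbz⟩ := hz l
    rw [← hbz]
    exact ((isNorm_supportDualNorm hN l).smul_of_nonneg (hw_nonneg _) b).trans_le
      (mul_le_of_le_one_right (hw_nonneg _) (mem_supportBall_succ.1 hb))
  refine ⟨z, ⟨(Finset.sum_le_sum fun l _ => hle l).trans ?_, hzx⟩, hle⟩
  rw [Fin.sum_univ_succ] at hw_sum
  linarith [hw_nonneg 0]

theorem isMinOver_simplexFeasible [NeZero d] (hN : IsNorm N) (hmono : OrthantStrictlyMonotonic N)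
    (hφ : Monotone φ) (hφ_zero : φ 0 = 0) {B : ℕ → Set (Fin d → ℝ)}
    (hB : ∀ l, supportSphere N l ⊆ B l) (hB' : ∀ l, B l ⊆ supportBall N l) (x : Fin d → ℝ) :
    IsMinOver (simplexFeasible B x) (fun w => ∑ l : Fin d, w l.succ * φ l.succ)
      (calL N φ x) := by
  refine (isMinOver_decompositions hN hmono hφ hφ_zero x).transfer (fun z hz => ?_) fun w hw => ?_
  · obtain ⟨w, hw, hwz⟩ := exists_mem_simplexFeasible_supportSphere hN hz
    exact ⟨w, simplexFeasible_mono hB x hw, by simp only [hwz, mul_comm, le_refl]⟩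
  · obtain ⟨z, hz, hzw⟩ :=
      exists_mem_decompositions_of_mem_simplexFeasible hN (simplexFeasible_mono hB' x hw)
    refine ⟨z, hz, Finset.sum_le_sum fun l _ => ?_⟩
    rw [mul_comm]
    exact mul_le_mul_of_nonneg_right (hzw l) (hφ_zero ▸ hφ (Fin.zero_le l.succ))

theorem isLargestConvexLscBelow_calL [NeZero d] (hN : IsNorm N) (hmono : OrthantStrictlyMonotonic N)
    (hφ : Monotone φ) (hφ_zero : φ 0 = 0) {B : ℕ → Set (Fin d → ℝ)}
    (hB : ∀ l, supportSphere N l ⊆ B l) (hB' : ∀ l, B l ⊆ supportBall N l) :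
    IsLargestConvexLscBelow (calL N φ) (stepFunction B φ) :=
  isLargestConvexLscBelow_stepFunction (isConvex_calL N φ) (lowerSemicontinuous_calL N φ)
    (fun _ => le_stepFunction_iff.2 fun l hx => calL_le_of_mem_supportBall hN hmono hφ (hB' l hx))
    (hB 0 (by simp [supportSphere])) hφ_zero
    fun x => (isMinOver_simplexFeasible hN hmono hφ hφ_zero hB hB' x).1

end Minima

end Capra

theorem mainTheorem2 (d : ℕ) (hd : 0 < d)
    -- a norm on `ℝ^d`: a seminorm that vanishes only at `0`
    (N : Seminorm ℝ (Fin d → ℝ)) (hN : ∀ x, N x = 0 → x = 0)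
    (hmono : OrthantStrictlyMonotonic N) (hmono_dual : OrthantStrictlyMonotonic (dualNorm N))
    (φ : Fin (d + 1) → ℝ) (hφ_nonneg : ∀ k, 0 ≤ φ k) (hφ_mono : Monotone φ) (hφ_zero : φ 0 = 0) :
    -- (a) proper convex lsc
    (IsProper (calL N φ) ∧ IsConvex (calL N φ) ∧ LowerSemicontinuous (calL N φ)) ∧
    -- (b) equality on the unit sphere
    (∀ s, N s = 1 → phiLzero φ s = calL N φ s) ∧
    -- (c) equality of the subdifferentials on the unit sphere
    (∀ s, N s = 1 → subdifferential (coupling N) (phiLzero φ) s =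
      subdifferential scalarProduct (calL N φ) s) ∧
    -- (d) convex factorization
    (phiLzero φ = calL N φ ∘ normalization N ∧
      ∀ x, x ≠ 0 → phiLzero φ x = calL N φ ((N x)⁻¹ • x)) ∧
    -- (e) expression as a conjugate
    (calL N φ = reverseFenchel
      (fun y => ⨆ l : Fin (d + 1), ((topDualNorm N l y - φ l : ℝ) : EReal))) ∧
    -- (f) largest convex lsc function below the step function on balls
    (IsLargestConvexLscBelow (calL N φ) (stepFunction (supportBall N) φ) ∧
      (∀ l : Fin d, ∀ x ∈ supportBall N (l + 1) \ supportBall N l,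
        stepFunction (supportBall N) φ x = (φ l.succ : EReal)) ∧
      stepFunction (supportBall N) φ 0 = 0 ∧
      (∀ x, x ∉ supportBall N d → stepFunction (supportBall N) φ x = ⊤) ∧
      (∀ l : Fin d, supportBall N l ⊆ supportBall N (l + 1)) ∧
      supportBall N d = {x | N x ≤ 1}) ∧
    -- (g) largest convex lsc function below the step function on spheres
    (IsLargestConvexLscBelow (calL N φ) (stepFunction (supportSphere N) φ) ∧
      ∀ x, stepFunction (supportSphere N) φ x =
        sInf ((fun l : Fin (d + 1) => (φ l : EReal)) '' {l | x ∈ supportSphere N l})) ∧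
    -- (h) three variational expressions
    (∀ x,
      IsMinOver (simplexFeasible (supportBall N) x)
        (fun w => ∑ l : Fin d, w l.succ * φ l.succ) (calL N φ x) ∧
      IsMinOver (simplexFeasible (supportSphere N) x)
        (fun w => ∑ l : Fin d, w l.succ * φ l.succ) (calL N φ x) ∧
      IsMinOver (decompositions N x)
        (fun z => ∑ l : Fin d, φ l.succ * supportDualNorm N (l + 1) (z l)) (calL N φ x)) := by
  have : NeZero d := ⟨hd.ne'⟩
  have hN' : IsNorm N := ⟨⟨N, rfl⟩, hN⟩
  have hfact := phiLzero_eq_calL_comp_normalization hN' hmono hmono_dual hφ_mono hφ_zero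
  have hsub := supportSphere_subset_supportBall N
  refine ⟨⟨isProper_calL hN' hmono hφ_mono hφ_zero, isConvex_calL N φ,
      lowerSemicontinuous_calL N φ⟩,
    fun s hs => phiLzero_eq_calL hN' hmono hmono_dual hφ_mono hφ_zero hs,
    fun s hs => subdifferential_coupling_eq hN' hmono hmono_dual hφ_mono hφ_zero hs,
    ⟨hfact, fun x hx => by simpa [normalization, hx] using congrFun hfact x⟩,
    by simp only [calL_eq_reverseFenchel hN' hmono hφ_mono, coe_capraConjugate],
    ⟨isLargestConvexLscBelow_calL hN' hmono hφ_mono hφ_zero hsub fun _ => subset_rfl,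
      fun l x hx => stepFunction_supportBall_of_mem_diff hN' hφ_mono hx,
      stepFunction_supportBall_zero N hφ_mono hφ_zero,
      fun x hx => stepFunction_supportBall_eq_top hN' hx,
      fun l => supportBall_mono hN' l.val.le_succ, supportBall_self hN' hmono_dual⟩,
    ⟨isLargestConvexLscBelow_calL hN' hmono hφ_mono hφ_zero (fun _ => subset_rfl) hsub,
      stepFunction_eq_sInf _ φ⟩,
    fun x =>
      ⟨isMinOver_simplexFeasible hN' hmono hφ_mono hφ_zero hsub (fun _ => subset_rfl) x,
        isMinOver_simplexFeasible hN' hmono hφ_mono hφ_zero (fun _ => subset_rfl) hsub x,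
        isMinOver_decompositions hN' hmono hφ_mono hφ_zero x⟩⟩
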